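/- A permutation of order $n$ is a bijection $\pi:[n]\to[n]$, and $|\pi|=n$. Points $i_1<\dots<i_m$ of $[n]$ induce in $\pi$ the permutation $\sigma$ of order $m$ if, for all $j,j'\in[m]$, $\sigma(j)<\sigma(j')$ holds if and only if $\pi(i_j)<\pi(i_{j'})$. For $|\sigma|\le|\pi|$, the density $d(\sigma,\pi)$ is the probability that $|\sigma|$ randomly chosen distinct points of $[|\pi|]$ induce $\sigma$. A permutation $\pi$ with $|\pi|\ge|\sigma|$ is $\sigma$-optimal if $d(\sigma,\pi)\ge d(\sigma,\tau)$ for every permutation $\tau$ of order $|\pi|$. A permutation $\pi$ of order $n$ is layered with layers of sizes $(|I_1|,\dots,|I_k|)$ if $[n]$ is partitioned into consecutive nonempty intervals $I_1,\dots,I_k$ (its layers, indexed from left to right) such that $\pi$ is decreasing on each $I_j$, and $\pi(x)<\pi(x')$ whenever $x\in I_j$, $x'\in I_{j'}$ and $j<j'$. Theorem. Let $\sigma$ be a layered permutation with layers of sizes $(\ell_1,\dots,\ell_k)$, where $k\ge2$. If $\ell_1=\ell_k\ge2$ and every two consecutive layers of $\sigma$ include one of size $\ell_1$ (that is, $\ell_i=\ell_1$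 or $\ell_{i+1}=\ell_1$ for every $1\le i\le k-1$), then there exists an integer $K\in\mathbb{N}$ such that every $\sigma$-optimal layered permutation, of any order, has at most $K$ layers. -/

import Mathlib

namespace LayeredPerm

/-- The points of `s` (taken in increasing order `i_1 < ⋯ < i_m`) induce the permutation `σ` of
order `m` in the permutation `π` of order `n`: there are `m` points, and
`σ j < σ j'` if and only if `π i_j < π i_{j'}`. -/
def Induces {m n : ℕ} (π : Equiv.Perm (Fin n)) (s : Finset (Fin n)) (σ : Equiv.Perm (Fin m)) :
    Prop :=
  ∃ h : s.card = m, ∀ j j' : Fin m,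
    σ j < σ j' ↔ π (s.orderEmbOfFin h j) < π (s.orderEmbOfFin h j')

instance {m n : ℕ} (π : Equiv.Perm (Fin n)) (σ : Equiv.Perm (Fin m)) :
    DecidablePred fun s : Finset (Fin n) => Induces π s σ :=
  fun s => by unfold Induces; infer_instance

/-- The density `d(σ, π)`: the probability that `|σ|` randomly chosen distinct points of the
domain of `π` induce `σ`. It is used only for `|σ| ≤ |π|`. -/
def density {m n : ℕ} (σ : Equiv.Perm (Fin m)) (π : Equiv.Perm (Fin n)) : ℚ :=
  ((Finset.powersetCard m (Finset.univ : Finset (Fin n))).filter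
      (fun s => Induces π s σ)).card /
    (Finset.powersetCard m (Finset.univ : Finset (Fin n))).card

/-- `π` is `σ`-optimal: its order is at least `|σ|`, and it has the largest density of `σ` among
all permutations (layered or not) of its order. -/
def IsOptimal {m n : ℕ} (σ : Equiv.Perm (Fin m)) (π : Equiv.Perm (Fin n)) : Prop :=
  m ≤ n ∧ ∀ τ : Equiv.Perm (Fin n), density σ τ ≤ density σ π

/-- `π` is layered, and its layers, from left to right, are the blocks of the composition `c`
of `n` (consecutive nonempty intervals partitioning the domain): `π` is decreasing on each block,
and all its values on a block are smaller than all its values on any later block.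
Here `c.index x` is the number of the block containing `x`; `c.length` is the number of layers
and `c.blocksFun i` the size of the `i`-th layer. -/
def HasLayers {n : ℕ} (π : Equiv.Perm (Fin n)) (c : Composition n) : Prop :=
  (∀ x y : Fin n, c.index x = c.index y → x < y → π y < π x) ∧
    (∀ x y : Fin n, c.index x < c.index y → π x < π y)

end LayeredPerm

/-! In a layered host, a copy of the pattern places its `k` layers in distinct host layers, in
order, so the number of copies is determined by the host's layer sizes through the recursion
`prefixCount`. Only layered competitors are needed from optimality.

Write `l` for the common size of the first and last pattern layers, `m` for the order of the
pattern, and merge two neighbouring host layers of sizes `a` and `b`. The copies destroyed are those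
placing two consecutive pattern layers in them, one in each. New copies arise when a pattern layer
goes into the merged layer across both parts. With `δ = C(a+b, l) - C(a, l) - C(b, l)`, the gain is
at least `δ * P`, where `P` counts copies of the pattern minus one layer of size `l` that avoid the
two host layers. An optimal host has at least `n ^ m / D` copies, by comparison with a blow-up
(`exists_pow_le_prefixCount`). Most copies avoid the two layers if `a + b` is small compared with
`n`, and at any cut of the pattern an adjacent layer has size `l`, so removing it shows that `P` has
order `n ^ (m - l)` (`prefixCount_mul_suffixCount_le`). One of two consecutive pattern layers has
size `l`, so the loss is at most of order `(a + b) * δ * n ^ (m - l - 1)` (`pow_mul_lost_le`). Hence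
merging never hurts when `a + b` is at most a small multiple of `n`, and helps strictly when also `l
≤ a + b` (`prefixCount_merge_le`).

Thus in an optimal host any `l` consecutive layers have total size greater than `n / M` for a
constant `M`: otherwise merging them one by one would end with a strict gain. Cutting the host into
segments of `l` layers bounds the number of layers by `l * M`. -/

namespace LayeredPerm

/-! ### Recursive counts of copies and cutting the host in two -/

/-- The number of copies of the first `r` layers of a pattern with layer sizes `z 0, z 1, …` in a
layered permutation whose layer sizes, from right to left, are `xs`. -/
def prefixCount (z : ℕ → ℕ) : List ℕ → ℕ → ℕ
  | _, 0 => 1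
  | [], _ + 1 => 0
  | x :: xs, r + 1 => prefixCount z xs (r + 1) + x.choose (z r) * prefixCount z xs r

/-- The number of copies of the layers `r, …, k - 1` of a pattern with layer sizes `z 0, z 1, …` in
a layered permutation whose layer sizes, from left to right, are `ys`. -/
def suffixCount (z : ℕ → ℕ) (k : ℕ) : List ℕ → ℕ → ℕ
  | [], r => if r = k then 1 else 0
  | y :: ys, r => suffixCount z k ys r + y.choose (z r) * suffixCount z k ys (r + 1)

variable {z : ℕ → ℕ} {k : ℕ}

@[simp] theorem prefixCount_zero (xs : List ℕ) : prefixCount z xs 0 = 1 := by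
  cases xs <;> rfl

theorem prefixCount_nil_succ (r : ℕ) : prefixCount z [] (r + 1) = 0 := rfl

theorem prefixCount_cons_succ (x : ℕ) (xs : List ℕ) (r : ℕ) :
    prefixCount z (x :: xs) (r + 1) =
      prefixCount z xs (r + 1) + x.choose (z r) * prefixCount z xs r := rfl

theorem suffixCount_of_lt (ys : List ℕ) : ∀ r, k < r → suffixCount z k ys r = 0 := by
  induction ys with
  | nil => intro r hr; simp [suffixCount, hr.ne']
  | cons y ys ih => intro r hr; simp [suffixCount, ih r hr, ih (r + 1) (by omega)]

theorem suffixCount_self (ys : List ℕ) : suffixCount z k ys k = 1 := by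
  induction ys with
  | nil => simp [suffixCount]
  | cons y ys ih => simp [suffixCount, ih, suffixCount_of_lt ys (k + 1) k.lt_succ_self]

/-- Both sides count all copies according to the number `r` of pattern layers to the left of a cut
in the host; the cut lies just to the right of `x` on one side and just to the left of `x` on the
other. -/
theorem sum_prefixCount_mul_suffixCount_cons (x : ℕ) (xs ys : List ℕ) :
    ∑ r ∈ Finset.range (k + 1), prefixCount z (x :: xs) r * suffixCount z k ys r =
      ∑ r ∈ Finset.range (k + 1), prefixCount z xs r * suffixCount z k (x :: ys) r := by
  have h : ∑ r ∈ Finset.range (k + 1), prefixCount z xs r * suffixCount z k (x :: ys) r =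
      ∑ r ∈ Finset.range (k + 1), prefixCount z xs r * suffixCount z k ys r +
      ∑ r ∈ Finset.range k, x.choose (z r) * prefixCount z xs r * suffixCount z k ys (r + 1) := by
    rw [Finset.sum_range_succ _ k, Finset.sum_range_succ _ k]
    simp only [suffixCount, suffixCount_of_lt ys (k + 1) k.lt_succ_self, mul_add,
      Finset.sum_add_distrib]
    have : ∀ r, prefixCount z xs r * (x.choose (z r) * suffixCount z k ys (r + 1)) =
        x.choose (z r) * prefixCount z xs r * suffixCount z k ys (r + 1) := fun r => by ring
    simp only [this]
    ring
  rw [h, Finset.sum_range_succ' _ k, Finset.sum_range_succ' _ k]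
  simp only [prefixCount_cons_succ, add_mul, Finset.sum_add_distrib, prefixCount_zero]
  ring

theorem prefixCount_reverse_append (ys : List ℕ) : ∀ xs : List ℕ,
    prefixCount z (ys.reverse ++ xs) k =
      ∑ r ∈ Finset.range (k + 1), prefixCount z xs r * suffixCount z k ys r := by
  induction ys with
  | nil => intro xs; simp [suffixCount]
  | cons y ys ih =>
    intro xs
    rw [← sum_prefixCount_mul_suffixCount_cons, ← ih]
    simp

/-! ### Polynomial bounds in the order of the host -/

theorem prefixCount_le_cons (x : ℕ) (xs : List ℕ) (r : ℕ) :
    prefixCount z xs r ≤ prefixCount z (x :: xs) r := by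
  cases r with
  | zero => simp
  | succ r => rw [prefixCount_cons_succ]; omega

theorem choose_add_pow_le (x s : ℕ) {p : ℕ} (hp : 1 ≤ p) :
    s ^ p + x.choose p ≤ (x + s) ^ p := by
  have h1 := Nat.choose_le_pow x p
  have h2 : x ^ p + s ^ p ≤ (x + s) ^ p := pow_add_pow_le (Nat.zero_le x) (Nat.zero_le s) (by omega)
  omega

theorem prefixCount_succ_le (hz : ∀ r, 1 ≤ z r) (xs : List ℕ) (r : ℕ) :
    prefixCount z xs (r + 1) ≤ xs.sum ^ z r * prefixCount z xs r := by
  induction xs with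
  | nil => simp [prefixCount_nil_succ]
  | cons x xs ih =>
    rw [prefixCount_cons_succ, List.sum_cons]
    calc _ ≤ xs.sum ^ z r * prefixCount z xs r + x.choose (z r) * prefixCount z xs r := by gcongr
      _ = (xs.sum ^ z r + x.choose (z r)) * prefixCount z xs r := by ring
      _ ≤ _ := Nat.mul_le_mul (choose_add_pow_le _ _ (hz r)) (prefixCount_le_cons x xs r)

theorem suffixCount_le_succ (hz : ∀ r, 1 ≤ z r) (ys : List ℕ) (r : ℕ) (hr : r < k) :
    suffixCount z k ys r ≤ ys.sum ^ z r * suffixCount z k ys (r + 1) := by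
  induction ys with
  | nil => simp [suffixCount, hr.ne]
  | cons y ys ih =>
    rw [List.sum_cons]
    calc _ ≤ ys.sum ^ z r * suffixCount z k ys (r + 1)
          + y.choose (z r) * suffixCount z k ys (r + 1) := by rw [suffixCount]; gcongr
      _ = (ys.sum ^ z r + y.choose (z r)) * suffixCount z k ys (r + 1) := by ring
      _ ≤ _ := Nat.mul_le_mul (choose_add_pow_le _ _ (hz r)) (by rw [suffixCount]; omega)

theorem prefixCount_le_pow (hz : ∀ r, 1 ≤ z r) {n : ℕ} (xs : List ℕ) (hn : xs.sum ≤ n) (r : ℕ) :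
    prefixCount z xs r ≤ n ^ ∑ i ∈ Finset.range r, z i := by
  induction r with
  | zero => simp
  | succ r ih =>
    rw [Finset.sum_range_succ, pow_add, mul_comm]
    exact (prefixCount_succ_le hz xs r).trans (Nat.mul_le_mul (Nat.pow_le_pow_left hn _) ih)

/-- Multiplying by the power for the first `r` layers avoids a subtraction in the exponent. -/
theorem suffixCount_mul_pow_le (hz : ∀ r, 1 ≤ z r) {n : ℕ} (ys : List ℕ) (hn : ys.sum ≤ n) (r : ℕ)
    (hr : r ≤ k) :
    suffixCount z k ys r * n ^ ∑ i ∈ Finset.range r, z i ≤ n ^ ∑ i ∈ Finset.range k, z i := by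
  induction hr using Nat.decreasingInduction with
  | self => simp [suffixCount_self]
  | of_succ r hr ih =>
    refine le_trans ?_ ih
    rw [Finset.sum_range_succ, pow_add]
    calc _ ≤ (ys.sum ^ z r * suffixCount z k ys (r + 1)) * n ^ ∑ i ∈ Finset.range r, z i := by
          gcongr; exact suffixCount_le_succ hz ys r hr
      _ ≤ (n ^ z r * suffixCount z k ys (r + 1)) * n ^ ∑ i ∈ Finset.range r, z i := by gcongr
      _ = _ := by ring

/-! ### Superadditivity of binomial coefficients -/

theorem choose_add_choose_le (a b p : ℕ) (hp : 1 ≤ p) :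
    a.choose p + b.choose p ≤ (a + b).choose p := by
  obtain ⟨p, rfl⟩ := Nat.exists_eq_add_of_le' hp
  induction b with
  | zero => simp
  | succ b ih =>
    rw [← add_assoc, Nat.choose_succ_succ' (a + b), Nat.choose_succ_succ' b]
    have := Nat.choose_le_choose p (show b ≤ a + b by omega)
    omega

/-- The third term counts the sets with one point in the part of size `b` and the others in the part
of size `a`. -/
theorem choose_add_choose_add_mul_le (a b t : ℕ) :
    a.choose (t + 2) + b.choose (t + 2) + b * a.choose (t + 1) ≤ (a + b).choose (t + 2) := by
  induction b with
  | zero => simp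
  | succ b ih =>
    rw [← add_assoc, Nat.choose_succ_succ' (a + b), Nat.choose_succ_succ' b]
    have := choose_add_choose_le a b (t + 1) (by omega)
    rw [add_mul, one_mul]
    change a.choose (t + 2) + (b.choose (t + 1) + b.choose (t + 2)) + _ ≤
      (a + b).choose (t + 1) + (a + b).choose (t + 2)
    omega

theorem choose_add_choose_lt {a b l : ℕ} (ha : 1 ≤ a) (hb : 1 ≤ b) (hl : 2 ≤ l)
    (h : l ≤ a + b) : a.choose l + b.choose l < (a + b).choose l := by
  obtain ⟨t, rfl⟩ := Nat.exists_eq_add_of_le' hl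
  have h1 := choose_add_choose_add_mul_le a b t
  have h2 := choose_add_choose_add_mul_le b a t
  rw [add_comm b a] at h2
  by_cases h3 : t + 1 ≤ a
  · have := Nat.mul_pos hb (Nat.choose_pos h3)
    omega
  by_cases h4 : t + 1 ≤ b
  · have := Nat.mul_pos ha (Nat.choose_pos h4)
    omega
  rw [Nat.choose_eq_zero_of_lt (by omega : a < t + 2),
    Nat.choose_eq_zero_of_lt (by omega : b < t + 2)]
  exact Nat.choose_pos h

theorem choose_mul_pow_le {b p n : ℕ} (hp : 1 ≤ p) (hn : b ≤ n) :
    n * b.choose p ≤ b * n ^ p := by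
  obtain ⟨p, rfl⟩ := Nat.exists_eq_add_of_le' hp
  calc _ ≤ n * b ^ (p + 1) := by gcongr; exact Nat.choose_le_pow _ _
    _ = b * (b ^ p * n) := by ring
    _ ≤ b * (n ^ p * n) := by gcongr
    _ = _ := by ring

theorem choose_le_mul_choose (a t : ℕ) : a.choose (t + 1) ≤ a * a.choose t := by
  have h := Nat.choose_succ_right_eq a t
  calc _ ≤ a.choose (t + 1) * (t + 1) := Nat.le_mul_of_pos_right _ (by omega)
    _ = a.choose t * (a - t) := h
    _ ≤ a.choose t * a := by gcongr; omega
    _ = _ := by ring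

/-- The pairs of a copy inside one of two layers and a copy of another layer inside the other one
are few compared with the copies created by merging the two layers. -/
theorem mul_choose_mul_choose_le {a b l p n : ℕ} (hl : 2 ≤ l) (hp : 1 ≤ p) (hn : b ≤ n) :
    n * (a.choose l * b.choose p) ≤
      (a + b) * ((a + b).choose l - a.choose l - b.choose l) * n ^ p := by
  obtain ⟨t, rfl⟩ := Nat.exists_eq_add_of_le' hl
  have h1 := choose_add_choose_add_mul_le a b t
  calc _ = a.choose (t + 2) * (n * b.choose p) := by ring
    _ ≤ (a * a.choose (t + 1)) * (b * n ^ p) :=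
      Nat.mul_le_mul (choose_le_mul_choose a (t + 1)) (choose_mul_pow_le hp hn)
    _ = a * (b * a.choose (t + 1)) * n ^ p := by ring
    _ ≤ _ := by
      refine Nat.mul_le_mul_right _ (Nat.mul_le_mul (by omega) (by omega))

/-! ### Gain and loss when two neighbouring layers are merged -/

/-- The difference `prefixCount z (a :: A) r - prefixCount z A r` counts the copies that really use
`a`; together with a pattern layer in `b` they are the copies lost. The copies gained have pattern
layer `r` meeting both parts of the merged layer. -/
theorem prefixCount_merge (a b : ℕ) (A : List ℕ) (hz : ∀ r, 1 ≤ z r) (r : ℕ) :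
    prefixCount z ((a + b) :: A) (r + 1) +
        b.choose (z r) * (prefixCount z (a :: A) r - prefixCount z A r) =
      prefixCount z (b :: a :: A) (r + 1) +
        ((a + b).choose (z r) - a.choose (z r) - b.choose (z r)) * prefixCount z A r := by
  obtain ⟨d, hd⟩ := Nat.exists_eq_add_of_le (choose_add_choose_le a b (z r) (hz r))
  obtain ⟨e, he⟩ := Nat.exists_eq_add_of_le (prefixCount_le_cons (z := z) a A r)
  have h1 : (a + b).choose (z r) - a.choose (z r) - b.choose (z r) = d := by omega
  have h2 : prefixCount z (a :: A) r - prefixCount z A r = e := by omega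
  rw [h1, h2, prefixCount_cons_succ, prefixCount_cons_succ, prefixCount_cons_succ, hd, he]
  ring

theorem sum_prefixCount_merge (a b : ℕ) (A : List ℕ) (hz : ∀ r, 1 ≤ z r) (w : ℕ → ℕ) :
    ∑ r ∈ Finset.range (k + 1), prefixCount z ((a + b) :: A) r * w r +
        ∑ r ∈ Finset.range k,
          b.choose (z r) * (prefixCount z (a :: A) r - prefixCount z A r) * w (r + 1) =
      ∑ r ∈ Finset.range (k + 1), prefixCount z (b :: a :: A) r * w r +
        ∑ r ∈ Finset.range k,
          ((a + b).choose (z r) - a.choose (z r) - b.choose (z r)) * prefixCount z A r *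
            w (r + 1) := by
  rw [Finset.sum_range_succ' _ k, Finset.sum_range_succ' _ k]
  simp only [prefixCount_zero]
  have : ∀ r, prefixCount z ((a + b) :: A) (r + 1) * w (r + 1) +
        b.choose (z r) * (prefixCount z (a :: A) r - prefixCount z A r) * w (r + 1) =
      prefixCount z (b :: a :: A) (r + 1) * w (r + 1) +
        ((a + b).choose (z r) - a.choose (z r) - b.choose (z r)) * prefixCount z A r *
            w (r + 1) := fun r => by
    rw [← add_mul, ← add_mul, prefixCount_merge a b A hz r]
  have h := Finset.sum_congr (rfl : Finset.range k = Finset.range k) fun r _ => this r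
  rw [Finset.sum_add_distrib, Finset.sum_add_distrib] at h
  omega

/-- Copies that use the layer of size `x` form at most a fraction `x / n` of the trivial bound. -/
theorem mul_prefixCount_cons_le (hz : ∀ r, 1 ≤ z r) {n x : ℕ} {A : List ℕ}
    (hn : (x :: A).sum ≤ n) (r : ℕ) :
    n * prefixCount z (x :: A) r ≤
      n * prefixCount z A r + x * n ^ ∑ i ∈ Finset.range r, z i := by
  rw [List.sum_cons] at hn
  cases r with
  | zero => simp
  | succ r =>
    rw [prefixCount_cons_succ, Finset.sum_range_succ, pow_add]
    have h1 := choose_mul_pow_le (hz r) (show x ≤ n by omega)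
    have h2 := prefixCount_le_pow hz A (show A.sum ≤ n by omega) r
    calc _ = n * prefixCount z A (r + 1) + (n * x.choose (z r)) * prefixCount z A r := by ring
      _ ≤ n * prefixCount z A (r + 1) + (x * n ^ z r) * n ^ ∑ i ∈ Finset.range r, z i := by gcongr
      _ = _ := by ring

/-- A copy that avoids two given layers is turned, by removing one layer of size `l`, into
a copy of the rest of the pattern to which the two layers may contribute a layer of size `l`. -/
theorem prefixCount_mul_suffixCount_le (hz : ∀ r, 1 ≤ z r) {n l : ℕ} {A B : List ℕ}
    (hA : A.sum ≤ n) (hB : B.sum ≤ n) (hk : 1 ≤ k) (h0 : z 0 = l) (hlast : z (k - 1) = l)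
    (hcons : ∀ i, i + 1 < k → z i = l ∨ z (i + 1) = l) {r : ℕ} (hr : r ≤ k) :
    prefixCount z A r * suffixCount z k B r ≤
      n ^ l * ∑ s ∈ (Finset.range k).filter (fun s => z s = l),
        prefixCount z A s * suffixCount z k B (s + 1) := by
  have key : ∀ s, s < k → z s = l → prefixCount z A s * suffixCount z k B (s + 1) ≤
      ∑ s ∈ (Finset.range k).filter (fun s => z s = l),
        prefixCount z A s * suffixCount z k B (s + 1) := fun s hs hl =>
    Finset.single_le_sum (f := fun s => prefixCount z A s * suffixCount z k B (s + 1))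
      (fun _ _ => Nat.zero_le _) (by simp [hs, hl])
  have hright : r < k → z r = l → prefixCount z A r * suffixCount z k B r ≤
      n ^ l * ∑ s ∈ (Finset.range k).filter (fun s => z s = l),
        prefixCount z A s * suffixCount z k B (s + 1) := fun hs hl => by
    refine le_trans ?_ (Nat.mul_le_mul_left _ (key r hs hl))
    have h1 : suffixCount z k B r ≤ n ^ l * suffixCount z k B (r + 1) := by
      rw [← hl]
      exact (suffixCount_le_succ hz B r hs).trans (by gcongr)
    calc _ ≤ prefixCount z A r * (n ^ l * suffixCount z k B (r + 1)) := by gcongr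
      _ = _ := by ring
  rcases r with _ | s
  · exact hright hk h0
  have hleft : z s = l → prefixCount z A (s + 1) * suffixCount z k B (s + 1) ≤
      n ^ l * ∑ s ∈ (Finset.range k).filter (fun s => z s = l),
        prefixCount z A s * suffixCount z k B (s + 1) := fun hl => by
    refine le_trans ?_ (Nat.mul_le_mul_left _ (key s hr hl))
    have h1 : prefixCount z A (s + 1) ≤ n ^ l * prefixCount z A s := by
      rw [← hl]
      exact (prefixCount_succ_le hz A s).trans (by gcongr)
    calc _ ≤ (n ^ l * prefixCount z A s) * suffixCount z k B (s + 1) := by gcongr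
      _ = _ := by ring
  -- The layer removed is next to the cut: the last one if the cut is at the right end, otherwise
  -- whichever of the two neighbours has size `l`.
  rcases hr.eq_or_lt with h | h
  · exact hleft (by rw [← hlast, ← h]; rfl)
  · exact (hcons s h).elim hleft (hright h)

/-- A lost copy has pattern layer `r - 1` in `a` and layer `r` in `b`. One of them has size `l`, so
`mul_choose_mul_choose_le` applies to the pair; the rest of the copy is bounded by a power of `n`.
-/
theorem pow_mul_lost_le (hz : ∀ r, 1 ≤ z r) {n l a b : ℕ} {A B : List ℕ}
    (hA : A.sum ≤ n) (hB : B.sum ≤ n) (hab : a + b ≤ n) (hl : 2 ≤ l)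
    (hcons : ∀ i, i + 1 < k → z i = l ∨ z (i + 1) = l) {r : ℕ} (hr : r < k) :
    n ^ (l + 1) * (b.choose (z r) * (prefixCount z (a :: A) r - prefixCount z A r) *
        suffixCount z k B (r + 1)) ≤
      (a + b) * ((a + b).choose l - a.choose l - b.choose l) *
        n ^ ∑ i ∈ Finset.range k, z i := by
  rcases r with _ | s
  · simp
  rw [prefixCount_cons_succ, Nat.add_sub_cancel_left]
  set δ := (a + b).choose l - a.choose l - b.choose l
  have hv := prefixCount_le_pow hz A hA s
  have hw := suffixCount_mul_pow_le (k := k) hz B hB (s + 2) hr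
  rw [Finset.sum_range_succ, Finset.sum_range_succ, pow_add, pow_add] at hw
  have hvw : prefixCount z A s * suffixCount z k B (s + 2) * (n ^ z s * n ^ z (s + 1)) ≤
      n ^ ∑ i ∈ Finset.range k, z i := by
    refine le_trans ?_ hw
    calc _ ≤ n ^ (∑ i ∈ Finset.range s, z i) * suffixCount z k B (s + 2) *
          (n ^ z s * n ^ z (s + 1)) := by gcongr
      _ = _ := by ring
  have hc : n ^ (l + 1) * (b.choose (z (s + 1)) * a.choose (z s)) ≤
      (a + b) * δ * (n ^ z s * n ^ z (s + 1)) := by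
    rcases hcons s hr with h | h
    · have := mul_choose_mul_choose_le (a := a) hl (hz (s + 1)) (show b ≤ n by omega)
      rw [h]
      calc _ = n ^ l * (n * (a.choose l * b.choose (z (s + 1)))) := by ring
        _ ≤ n ^ l * ((a + b) * δ * n ^ z (s + 1)) := by gcongr
        _ = _ := by ring
    · have := mul_choose_mul_choose_le (a := b) hl (hz s) (show a ≤ n by omega)
      rw [add_comm b a, Nat.sub_right_comm] at this
      rw [h]
      calc _ = n ^ l * (n * (b.choose l * a.choose (z s))) := by ring
        _ ≤ n ^ l * ((a + b) * δ * n ^ z s) := by gcongr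
        _ = _ := by ring
  calc _ = (n ^ (l + 1) * (b.choose (z (s + 1)) * a.choose (z s))) *
        (prefixCount z A s * suffixCount z k B (s + 2)) := by ring
    _ ≤ ((a + b) * δ * (n ^ z s * n ^ z (s + 1))) *
        (prefixCount z A s * suffixCount z k B (s + 2)) := by gcongr
    _ = (a + b) * δ *
      (prefixCount z A s * suffixCount z k B (s + 2) * (n ^ z s * n ^ z (s + 1))) := by ring
    _ ≤ _ := by gcongr

/-- Merging two consecutive layers that are small does not decrease the number of copies, and
increases it if the merged layer has size at least `l`. -/
theorem prefixCount_merge_le (hz : ∀ r, 1 ≤ z r) {n l a b D : ℕ} {A B : List ℕ}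
    (hn : (B.reverse ++ b :: a :: A).sum = n) (hn0 : 1 ≤ n) (hl : 2 ≤ l) (hk : 1 ≤ k)
    (h0 : z 0 = l) (hlast : z (k - 1) = l)
    (hcons : ∀ i, i + 1 < k → z i = l ∨ z (i + 1) = l)
    (hD : n ^ (∑ i ∈ Finset.range k, z i) ≤ D * prefixCount z (B.reverse ++ b :: a :: A) k)
    (hab : 4 * (k + 1) ^ 2 * D * (a + b) ≤ n) :
    prefixCount z (B.reverse ++ b :: a :: A) k ≤ prefixCount z (B.reverse ++ (a + b) :: A) k ∧
    (1 ≤ a → 1 ≤ b → l ≤ a + b → prefixCount z (B.reverse ++ b :: a :: A) k <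
      prefixCount z (B.reverse ++ (a + b) :: A) k) := by
  simp only [List.sum_append, List.sum_reverse, List.sum_cons] at hn
  have hmerge := sum_prefixCount_merge (k := k) a b A hz (suffixCount z k B)
  rw [prefixCount_reverse_append] at hD ⊢
  rw [prefixCount_reverse_append]
  set F := ∑ r ∈ Finset.range (k + 1), prefixCount z (b :: a :: A) r * suffixCount z k B r with hF
  set m := ∑ i ∈ Finset.range k, z i
  -- `G` is the gain and `Λ` the loss; `P` allows only for pattern layers of size `l` in the merged
  -- layer.
  set G := ∑ r ∈ Finset.range k, ((a + b).choose (z r) - a.choose (z r) - b.choose (z r)) *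
    prefixCount z A r * suffixCount z k B (r + 1) with hG
  set Λ := ∑ r ∈ Finset.range k, b.choose (z r) * (prefixCount z (a :: A) r - prefixCount z A r) *
    suffixCount z k B (r + 1) with hΛ
  set P := ∑ s ∈ (Finset.range k).filter (fun s => z s = l),
        prefixCount z A s * suffixCount z k B (s + 1) with hP
  set δ := (a + b).choose l - a.choose l - b.choose l with hδ
  have hm0 : 0 < n ^ m := Nat.pow_pos hn0
  have hD0 : 1 ≤ D := by
    rcases D with _ | D
    · simp only [Nat.zero_mul] at hD; omega
    · omega
  have habn : a + b ≤ n := by omega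
  -- copies using neither of the two layers dominate
  have h1 : n * F ≤ (k + 1) * (n * (n ^ l * P)) + (k + 1) * ((a + b) * n ^ m) := by
    rw [hF, Finset.mul_sum]
    calc _ ≤ ∑ r ∈ Finset.range (k + 1), (n * (n ^ l * P) + (a + b) * n ^ m) := by
          refine Finset.sum_le_sum fun r hr => ?_
          have hr' : r ≤ k := by simpa [Nat.lt_succ_iff] using hr
          have e1 := mul_prefixCount_cons_le hz (x := b) (A := a :: A) (n := n)
            (by simp only [List.sum_cons]; omega) r
          have e2 := mul_prefixCount_cons_le hz (x := a) (A := A) (n := n)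
            (by simp only [List.sum_cons]; omega) r
          have e3 := prefixCount_mul_suffixCount_le hz (n := n) (A := A) (B := B)
            (by omega) (by omega) hk h0 hlast hcons hr'
          have e4 := suffixCount_mul_pow_le (k := k) (n := n) hz B (by omega) r hr'
          calc _ = (n * prefixCount z (b :: a :: A) r) * suffixCount z k B r := by ring
            _ ≤ (n * prefixCount z A r + a * n ^ (∑ i ∈ Finset.range r, z i) +
                b * n ^ (∑ i ∈ Finset.range r, z i)) * suffixCount z k B r := by
                  gcongr; omega
            _ = n * (prefixCount z A r * suffixCount z k B r) +
                (a + b) * (suffixCount z k B r * n ^ (∑ i ∈ Finset.range r, z i)) := by ring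
            _ ≤ _ := by gcongr
      _ = _ := by simp; ring
  have h2 : F ≤ 2 * (k + 1) * (n ^ l * P) := by
    -- The copies meeting the two layers account for at most half of the bound on `n * F`, so they
    -- can be absorbed in the left side.
    have e : 2 * (k + 1) * ((a + b) * n ^ m) ≤ n * F := by
      calc _ ≤ 2 * (k + 1) * ((a + b) * (D * F)) := by gcongr
        _ = (2 * (k + 1) * D * (a + b)) * F := by ring
        _ ≤ (4 * (k + 1) ^ 2 * D * (a + b)) * F := by
          gcongr
          · omega
          · nlinarith
        _ ≤ _ := by gcongr
    refine Nat.le_of_mul_le_mul_left ?_ hn0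
    nlinarith
  have h3 : n ^ (l + 1) * Λ ≤ k * ((a + b) * δ * n ^ m) := by
    rw [hΛ, Finset.mul_sum]
    calc _ ≤ ∑ r ∈ Finset.range k, (a + b) * δ * n ^ m :=
          Finset.sum_le_sum fun r hr => pow_mul_lost_le hz (by omega) (by omega) habn hl hcons
            (by simpa using hr)
      _ = _ := by simp
  -- The factor 2 makes the gain exceed the loss strictly as soon as `δ * P` is positive, even if
  -- `Λ` is not zero.
  have h4 : 2 * Λ ≤ δ * P := by
    have e : n ^ (l + 1) * (2 * Λ) ≤ n ^ (l + 1) * (δ * P) := by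
      calc _ = 2 * (n ^ (l + 1) * Λ) := by ring
        _ ≤ 2 * (k * ((a + b) * δ * (D * (2 * (k + 1) * (n ^ l * P))))) := by
          refine Nat.mul_le_mul_left _ (h3.trans ?_)
          gcongr
          exact hD.trans (by gcongr)
        _ = (4 * (k * (k + 1)) * D * (a + b)) * (n ^ l * (δ * P)) := by ring
        _ ≤ (4 * (k + 1) ^ 2 * D * (a + b)) * (n ^ l * (δ * P)) := by
          gcongr
          nlinarith
        _ ≤ n * (n ^ l * (δ * P)) := by gcongr
        _ = _ := by ring
    exact Nat.le_of_mul_le_mul_left e (Nat.pow_pos hn0)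
  have h5 : δ * P ≤ G := by
    rw [hP, hG, Finset.mul_sum]
    calc _ = ∑ r ∈ (Finset.range k).filter (fun s => z s = l),
          ((a + b).choose (z r) - a.choose (z r) - b.choose (z r)) *
            prefixCount z A r * suffixCount z k B (r + 1) := by
          refine Finset.sum_congr rfl fun r hr => ?_
          rw [(Finset.mem_filter.mp hr).2]
          ring
      _ ≤ _ := Finset.sum_le_sum_of_subset (Finset.filter_subset _ _)
  refine ⟨by omega, fun ha hb hlab => ?_⟩
  have hP0 : 0 < P := by
    rcases Nat.eq_zero_or_pos P with h | h
    · rw [h] at h2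
      have : F = 0 := by simpa using h2
      rw [this] at hD
      omega
    · exact h
  have hδ0 : 0 < δ := by
    have := choose_add_choose_lt ha hb hl hlab
    omega
  have := Nat.mul_pos hδ0 hP0
  omega

/-! ### A blow-up with many copies, and the bound on the number of layers -/

/-- The number of copies in a layered permutation whose layers are blown up from the pattern. -/
theorem exists_pow_le_prefixCount (z : ℕ → ℕ) (hz : ∀ r, 1 ≤ z r) (k : ℕ) :
    ∃ D, ∀ n, (∑ i ∈ Finset.range k, z i) ≤ n → ∃ ys : List ℕ, ys.sum = n ∧
      n ^ (∑ i ∈ Finset.range k, z i) ≤ D * prefixCount z ys k := by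
  have hinfl : ∀ r q, 1 ≤ q → ∃ ys : List ℕ, ys.sum = q * (∑ i ∈ Finset.range r, z i) ∧
      q ^ (∑ i ∈ Finset.range r, z i) ≤ (∏ i ∈ Finset.range r, (z i).factorial) *
        prefixCount z ys r := by
    intro r q hq
    induction r with
    | zero => exact ⟨[], by simp⟩
    | succ r ih =>
      obtain ⟨ys, h1, h2⟩ := ih
      refine ⟨q * z r :: ys, by rw [List.sum_cons, h1, Finset.sum_range_succ]; ring, ?_⟩
      rw [Finset.sum_range_succ, Finset.prod_range_succ, prefixCount_cons_succ, pow_add]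
      have h3 : q ^ z r ≤ (z r).factorial * (q * z r).choose (z r) := by
        rw [← Nat.descFactorial_eq_factorial_mul_choose]
        refine le_trans ?_ (Nat.pow_sub_le_descFactorial (q * z r) (z r))
        refine Nat.pow_le_pow_left ?_ _
        obtain ⟨q, rfl⟩ := Nat.exists_eq_add_of_le' hq
        have : q ≤ q * z r := Nat.le_mul_of_pos_right _ (hz r)
        rw [add_mul, one_mul]
        omega
      calc _ ≤ ((∏ i ∈ Finset.range r, (z i).factorial) * prefixCount z ys r) *
            ((z r).factorial * (q * z r).choose (z r)) := Nat.mul_le_mul h2 h3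
        _ = (∏ i ∈ Finset.range r, (z i).factorial) * (z r).factorial *
            ((q * z r).choose (z r) * prefixCount z ys r) := by ring
        _ ≤ _ := by gcongr; omega
  set m := ∑ i ∈ Finset.range k, z i with hm
  refine ⟨(2 * m) ^ m * ∏ i ∈ Finset.range k, (z i).factorial, fun n hn => ?_⟩
  rcases Nat.eq_zero_or_pos m with h0 | h0
  · have hk : k = 0 := by
      by_contra hk
      have := Finset.single_le_sum (f := z) (fun _ _ => Nat.zero_le _)
        (Finset.mem_range.mpr (Nat.pos_of_ne_zero hk))
      have := hz 0
      omega
    subst hk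
    exact ⟨[n], by simp, by simp [h0]⟩
  have hq : 1 ≤ n / m := Nat.div_pos hn h0
  obtain ⟨ys, h1, h2⟩ := hinfl k (n / m) hq
  -- The remainder becomes one extra, possibly empty, layer, which cannot reduce the count.
  refine ⟨(n % m) :: ys, ?_, ?_⟩
  · rw [List.sum_cons, h1]
    exact Nat.mod_add_div' n m
  have h3 : n ≤ 2 * m * (n / m) := by
    have := Nat.div_add_mod n m
    have := Nat.mod_lt n h0
    nlinarith
  calc n ^ m ≤ (2 * m * (n / m)) ^ m := Nat.pow_le_pow_left h3 _
    _ = (2 * m) ^ m * (n / m) ^ m := by rw [mul_pow]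
    _ ≤ (2 * m) ^ m * ((∏ i ∈ Finset.range k, (z i).factorial) * prefixCount z ys k) := by gcongr
    _ ≤ (2 * m) ^ m * ((∏ i ∈ Finset.range k, (z i).factorial) *
        prefixCount z ((n % m) :: ys) k) := by gcongr; exact prefixCount_le_cons _ _ _
    _ = _ := by ring

theorem mul_le_sum_of_forall_segment (l q : ℕ) : ∀ (t : ℕ) (xs : List ℕ), l * t ≤ xs.length →
    (∀ C G A, xs = C ++ (G ++ A) → G.length = l → q ≤ G.sum) → t * q ≤ xs.sum := by
  intro t
  induction t with
  | zero => simp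
  | succ t ih =>
    intro xs hlen h
    rw [Nat.mul_succ] at hlen
    have h1 := h [] (xs.take l) (xs.drop l) (by simp) (by simp; omega)
    have h2 := ih (xs.drop l) (by simp; omega) fun C G A hx hG =>
      h (xs.take l ++ C) G A (by rw [List.append_assoc, ← hx, List.take_append_drop]) hG
    have h3 : xs.sum = (xs.take l).sum + (xs.drop l).sum := by
      rw [← List.sum_append, List.take_append_drop]
    rw [h3, Nat.succ_mul]
    omega

/-- The number of nonempty layers of an optimal layered permutation is bounded. -/
theorem exists_length_le (hz : ∀ r, 1 ≤ z r) {l : ℕ} (hl : 2 ≤ l) (hk : 1 ≤ k)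
    (h0 : z 0 = l) (hlast : z (k - 1) = l)
    (hcons : ∀ i, i + 1 < k → z i = l ∨ z (i + 1) = l) :
    ∃ K, ∀ xs : List ℕ, (∀ x ∈ xs, 1 ≤ x) → (∑ i ∈ Finset.range k, z i) ≤ xs.sum →
      (∀ ys : List ℕ, ys.sum = xs.sum → prefixCount z ys k ≤ prefixCount z xs k) →
      xs.length ≤ K := by
  obtain ⟨D, hD⟩ := exists_pow_le_prefixCount z hz k
  -- `D + 1` in place of `D` keeps `M` positive.
  set M := 4 * (k + 1) ^ 2 * (D + 1) with hM
  have hM0 : 1 ≤ M := Nat.succ_le_of_lt (by positivity)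
  -- a short segment of total size at least `l` cannot occur
  have main : ∀ (n : ℕ), (∑ i ∈ Finset.range k, z i) ≤ n → 1 ≤ n →
      ∀ (G : List ℕ) (x : ℕ) (C A : List ℕ), G ≠ [] →
      (∀ y ∈ G, 1 ≤ y) → 1 ≤ x → l ≤ G.sum + x → M * (G.sum + x) ≤ n →
      (C ++ (G ++ x :: A)).sum = n →
      (∀ ys : List ℕ, ys.sum = n → prefixCount z ys k ≤ prefixCount z (C ++ (G ++ x :: A)) k) →
      False := by
    intro n hn hn0 G
    induction G using List.reverseRecOn with
    | nil => intro x C A h; exact absurd rfl h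
    | append_singleton G y ih =>
      intro x C A _ hG hx hlx hMx hsum hopt
      have hy : 1 ≤ y := hG y (by simp)
      have hlist : C ++ (G ++ [y] ++ x :: A) = (C ++ G).reverse.reverse ++ y :: x :: A := by simp
      have hlist' : (C ++ G).reverse.reverse ++ (x + y) :: A = C ++ (G ++ (x + y) :: A) := by simp
      have hsum' : (C ++ (G ++ (x + y) :: A)).sum = n := by
        rw [← hsum]; simp; ring
      rw [hlist] at hsum hopt
      obtain ⟨ys, hys, hysD⟩ := hD n hn
      simp only [List.sum_append, List.sum_cons, List.sum_nil] at hlx hMx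
      have hmg := prefixCount_merge_le (D := D + 1) hz hsum hn0 hl hk h0 hlast hcons
        (hysD.trans (Nat.mul_le_mul (by omega) (hopt ys hys)))
        (le_trans (Nat.mul_le_mul_left _ (by omega)) hMx)
      rw [hlist'] at hmg
      -- The last merge produces a layer of size at least `l` and gives the contradiction; earlier
      -- merges need only preserve optimality.
      by_cases hGn : G = []
      · subst hGn
        have := hmg.2 hx hy (by simp at hlx; omega)
        have := hopt _ hsum'
        omega
      · refine ih (x + y) C A hGn (fun t ht => hG t (by simp [ht])) (by omega) (by omega) ?_ hsum'
          fun ys hys => (hopt ys hys).trans hmg.1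
        convert hMx using 2
        ring
  refine ⟨l * M, fun xs hpos hn hopt => ?_⟩
  by_contra hlen
  have hn0 : 1 ≤ xs.sum := by
    have := Finset.single_le_sum (f := z) (fun _ _ => Nat.zero_le _)
        (Finset.mem_range.mpr hk)
    have := hz 0
    omega
  -- `M` disjoint segments, each of total size at least `n / M + 1`, would exceed `n`.
  have h1 := mul_le_sum_of_forall_segment l (xs.sum / M + 1) M xs (by omega) fun C G A hx hG => by
    by_contra hlt
    have hGpos : ∀ y ∈ G, 1 ≤ y := fun y hy => hpos y (by rw [hx]; simp [hy])
    obtain ⟨G', x, rfl⟩ : ∃ G' x, G = G' ++ [x] := by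
      rcases List.eq_nil_or_concat G with h | ⟨G', x, h⟩
      · subst h; simp at hG; omega
      · exact ⟨G', x, by simpa using h⟩
    have hG' : G' ≠ [] := by
      rintro rfl
      simp at hG; omega
    have hle : (G' ++ [x]).length ≤ (G' ++ [x]).sum := by
      have := List.card_nsmul_le_sum (G' ++ [x]) 1 hGpos
      simpa using this
    have hs : (G' ++ [x]).sum = G'.sum + x := by simp
    have hx' : xs = C ++ (G' ++ x :: A) := by rw [hx]; simp
    refine main xs.sum hn hn0 G' x C A hG' (fun y hy => hGpos y (by simp [hy]))
      (hGpos x (by simp)) (by omega) ?_ (by rw [← hx']) (by rw [← hx']; exact hopt)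
    rw [← hs]
    calc _ ≤ M * (xs.sum / M) := by gcongr; omega
      _ ≤ _ := Nat.mul_div_le _ _
  have h2 := Nat.div_add_mod xs.sum M
  have h3 := Nat.mod_lt xs.sum hM0
  rw [mul_add, mul_one] at h1
  omega

/-! ### Counting point sets by their labels -/

/-- The number of elements of `s` below `x`. -/
def rank {n : ℕ} (s : Finset (Fin n)) (x : Fin n) : ℕ := (s.filter (· < x)).card

/-- Two elements of `s` have the same label under `g` if and only if their ranks in `s` have the
same label under `f`. -/
def MatchesLabels {n : ℕ} (f : ℕ → ℕ) (g : Fin n → ℕ) (s : Finset (Fin n)) : Prop :=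
  ∀ x ∈ s, ∀ y ∈ s, g x = g y ↔ f (rank s x) = f (rank s y)

/-- The numbers of points with the labels `M - 1, …, 0`. -/
def labelSizes {n : ℕ} (g : Fin n → ℕ) : ℕ → List ℕ
  | 0 => []
  | M + 1 => (Finset.univ.filter (fun x => g x = M)).card :: labelSizes g M

theorem rank_filter_lt {n : ℕ} {g : Fin n → ℕ} (hg : Monotone g) {s : Finset (Fin n)} {M : ℕ}
    {x : Fin n} (hx : g x < M) : rank (s.filter (fun y => g y < M)) x = rank s x := by
  unfold rank
  congr 1
  ext y
  simp only [Finset.mem_filter]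
  exact ⟨fun h => ⟨h.1.1, h.2⟩, fun h => ⟨⟨h.1, (hg h.2.le).trans_lt hx⟩, h.2⟩⟩

theorem rank_lt_card {n : ℕ} {s : Finset (Fin n)} {x : Fin n} (hx : x ∈ s) : rank s x < s.card :=
  Finset.card_lt_card (Finset.filter_ssubset.mpr ⟨x, hx, lt_irrefl x⟩)

theorem rank_max' {n : ℕ} (s : Finset (Fin n)) (hs : s.Nonempty) :
    rank s (s.max' hs) + 1 = s.card := by
  have : s.filter (· < s.max' hs) = s.erase (s.max' hs) := by
    ext y
    simp only [Finset.mem_filter, Finset.mem_erase]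
    exact ⟨fun h => ⟨h.2.ne, h.1⟩, fun h => ⟨h.2, lt_of_le_of_ne (s.le_max' y h.2) h.1⟩⟩
  rw [rank, this, Finset.card_erase_add_one (s.max'_mem hs)]

section Counting

variable {n : ℕ} {z f : ℕ → ℕ} {k : ℕ} {g : Fin n → ℕ}

theorem label_lt_iff (hz : ∀ r, 1 ≤ z r)
    (hf : ∀ r < k, ∀ j, f j = r ↔
      ∑ i ∈ Finset.range r, z i ≤ j ∧ j < ∑ i ∈ Finset.range (r + 1), z i)
    {r : ℕ} (hr : r ≤ k) (j : ℕ) : f j < r ↔ j < ∑ i ∈ Finset.range r, z i := by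
  induction r with
  | zero => simp
  | succ r ih =>
    have h1 := ih (by omega)
    have h2 := hf r hr j
    have := hz r
    rw [Finset.sum_range_succ] at *
    omega

/-- Splitting off the points with the last label. -/
theorem matchesLabels_split (hz : ∀ r, 1 ≤ z r)
    (hf : ∀ r < k, ∀ j, f j = r ↔
      ∑ i ∈ Finset.range r, z i ≤ j ∧ j < ∑ i ∈ Finset.range (r + 1), z i)
    (hg : Monotone g) {r M : ℕ} (hr : r < k) {s : Finset (Fin n)} (hs : ∀ x ∈ s, g x ≤ M)
    (hne : (s.filter (fun x => g x = M)).Nonempty) :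
    (s.card = ∑ i ∈ Finset.range (r + 1), z i ∧ MatchesLabels f g s) ↔
      ((s.filter (fun x => g x < M)).card = ∑ i ∈ Finset.range r, z i ∧
        MatchesLabels f g (s.filter (fun x => g x < M))) ∧
        (s.filter (fun x => g x = M)).card = z r := by
  set u := s.filter (fun x => g x < M) with hu
  set t := s.filter (fun x => g x = M) with ht
  have hcard : s.card = u.card + t.card := by
    rw [← Finset.card_filter_add_card_filter_not (s := s) (fun x => g x < M)]
    congr 2
    ext x
    simp only [ht, Finset.mem_filter]
    exact ⟨fun h => ⟨h.1, by have := hs x h.1; omega⟩, fun h => ⟨h.1, by omega⟩⟩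
  have hSr : ∑ i ∈ Finset.range (r + 1), z i = ∑ i ∈ Finset.range r, z i + z r :=
    Finset.sum_range_succ _ _
  have hzr := hz r
  have hrk_u : ∀ x ∈ u, rank s x = rank u x := fun x hx =>
    (rank_filter_lt hg (Finset.mem_filter.mp hx).2).symm
  have hrk_t : ∀ x ∈ t, u.card ≤ rank s x := fun x hx => by
    refine Finset.card_le_card fun y hy => ?_
    rw [hu, Finset.mem_filter] at hy
    rw [ht, Finset.mem_filter] at hx
    exact Finset.mem_filter.mpr ⟨hy.1, hg.reflect_lt (by omega)⟩
  constructor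
  · rintro ⟨hc, hm⟩
    have hmu : MatchesLabels f g u := fun x hx y hy => by
      rw [← hrk_u x hx, ← hrk_u y hy]
      exact hm x (Finset.mem_filter.mp hx).1 y (Finset.mem_filter.mp hy).1
    obtain ⟨y, hy⟩ := hne
    have hys : y ∈ s := (Finset.mem_filter.mp hy).1
    have hsne : s.Nonempty := ⟨y, hys⟩
    obtain ⟨top, htops, htop, hrk⟩ : ∃ top ∈ s, (∀ x ∈ s, x ≤ top) ∧ rank s top + 1 = s.card :=
      ⟨s.max' hsne, s.max'_mem hsne, fun x hx => s.le_max' x hx, rank_max' s hsne⟩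
    have hgtop : g top = M := by
      have h1 := hs top htops
      have h2 := hg (htop y hys)
      have h3 := (Finset.mem_filter.mp hy).2
      omega
    have hftop : f (rank s top) = r := (hf r hr _).mpr (by omega)
    -- Comparison with the largest point of `s`, which has label `M` and whose rank has label `r`.
    have key : ∀ x ∈ s, g x = M ↔ ∑ i ∈ Finset.range r, z i ≤ rank s x := fun x hx => by
      have h1 := hm x hx top htops
      rw [hgtop, hftop, hf r hr] at h1
      have := rank_lt_card hx
      rw [h1]
      omega
    -- the smallest point of the last layer has rank `u.card`
    have hlow : ∑ i ∈ Finset.range r, z i ≤ u.card := by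
      have h1 := t.min'_mem ⟨y, hy⟩
      have h2 := Finset.mem_filter.mp h1
      refine ((key _ h2.1).mp h2.2).trans (Finset.card_le_card fun x hx => ?_)
      obtain ⟨hxs, hxlt⟩ := Finset.mem_filter.mp hx
      refine Finset.mem_filter.mpr ⟨hxs, lt_of_le_of_ne (hs x hxs) fun h => ?_⟩
      exact absurd hxlt (not_lt.mpr (t.min'_le x (Finset.mem_filter.mpr ⟨hxs, h⟩)))
    have hhigh : u.card ≤ ∑ i ∈ Finset.range r, z i := by
      rcases u.eq_empty_or_nonempty with h | h
      · simp [h]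
      have h1 := rank_max' u h
      have h2 := u.max'_mem h
      have h3 := Finset.mem_filter.mp h2
      have h4 := key _ h3.1
      rw [hrk_u _ h2] at h4
      omega
    exact ⟨⟨by omega, hmu⟩, by omega⟩
  · rintro ⟨⟨hc, hm⟩, htc⟩
    refine ⟨by omega, ?_⟩
    have hfu : ∀ x ∈ u, f (rank s x) < r := fun x hx => by
      rw [label_lt_iff hz hf hr.le, hrk_u x hx, ← hc]
      exact rank_lt_card hx
    have hft : ∀ x ∈ t, f (rank s x) = r := fun x hx => by
      have h1 := rank_lt_card (Finset.mem_filter.mp hx).1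
      have h2 := hrk_t x hx
      exact (hf r hr _).mpr (by omega)
    have hcase : ∀ x ∈ s, (x ∈ u ∧ g x < M) ∨ (x ∈ t ∧ g x = M) := fun x hx => by
      rcases (hs x hx).lt_or_eq with h | h
      · exact Or.inl ⟨Finset.mem_filter.mpr ⟨hx, h⟩, h⟩
      · exact Or.inr ⟨Finset.mem_filter.mpr ⟨hx, h⟩, h⟩
    intro x hx y hy
    rcases hcase x hx with ⟨hx1, hx2⟩ | ⟨hx1, hx2⟩ <;>
      rcases hcase y hy with ⟨hy1, hy2⟩ | ⟨hy1, hy2⟩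
    · rw [hrk_u x hx1, hrk_u y hy1]
      exact hm x hx1 y hy1
    · have := hfu x hx1
      have := hft y hy1
      omega
    · have := hft x hx1
      have := hfu y hy1
      omega
    · have := hft x hx1
      have := hft y hy1
      omega

-- The recursion of `prefixCount` separates the sets with no point labelled `M` from the others; the
-- latter split into their points below label `M` and their points labelled `M`.
open Classical in
theorem card_matchesLabels (hz : ∀ r, 1 ≤ z r)
    (hf : ∀ r < k, ∀ j, f j = r ↔
      ∑ i ∈ Finset.range r, z i ≤ j ∧ j < ∑ i ∈ Finset.range (r + 1), z i)
    (hg : Monotone g) (M : ℕ) : ∀ r ≤ k,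
    ((Finset.univ.filter (fun x => g x < M)).powerset.filter fun s =>
      s.card = ∑ i ∈ Finset.range r, z i ∧ MatchesLabels f g s).card =
      prefixCount z (labelSizes g M) r := by
  induction M with
  | zero =>
    intro r hr
    rcases r with _ | r
    · simp [MatchesLabels, Finset.filter_singleton]
    · have := hz r
      have h : 0 ≠ ∑ i ∈ Finset.range (r + 1), z i := by rw [Finset.sum_range_succ]; omega
      simp [labelSizes, prefixCount_nil_succ, Finset.filter_singleton, h]
  | succ M ih =>
    intro r hr
    rcases r with _ | r
    · rw [prefixCount_zero, Finset.card_eq_one]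
      refine ⟨∅, ?_⟩
      ext s
      simp only [Finset.mem_filter, Finset.mem_powerset, Finset.range_zero, Finset.sum_empty,
        Finset.card_eq_zero, Finset.mem_singleton]
      refine ⟨fun h => h.2.1, ?_⟩
      rintro rfl
      simp [MatchesLabels]
    rw [labelSizes, prefixCount_cons_succ, ← ih (r + 1) hr, ← ih r (by omega), mul_comm,
      ← Finset.card_powersetCard, ← Finset.card_product,
      ← Finset.card_filter_add_card_filter_not (fun s => s.filter (fun x => g x = M) = ∅)]
    congr 1
    · congr 1
      ext s
      simp only [Finset.mem_filter, Finset.mem_powerset, Finset.filter_eq_empty_iff,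
        Finset.subset_iff, Finset.mem_univ, true_and]
      constructor
      · rintro ⟨⟨h1, h2⟩, h3⟩
        exact ⟨fun x hx => by have := h1 hx; have := h3 hx; omega, h2⟩
      · rintro ⟨h1, h2⟩
        exact ⟨⟨fun x hx => by have := h1 hx; omega, h2⟩,
          fun x hx => by have := h1 hx; omega⟩
    · have hun : ∀ u t : Finset (Fin n), (∀ x ∈ u, g x < M) → (∀ x ∈ t, g x = M) →
          (u ∪ t).filter (fun x => g x < M) = u ∧ (u ∪ t).filter (fun x => g x = M) = t := by
        intro u t hu ht
        constructor <;>
        · ext x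
          simp only [Finset.mem_filter, Finset.mem_union]
          have := hu x
          have := ht x
          constructor
          · rintro ⟨h1 | h1, h2⟩
            · first | exact h1 | (have := hu x h1; omega)
            · first | exact h1 | (have := ht x h1; omega)
          · intro h
            first
              | exact ⟨Or.inl h, hu x h⟩
              | exact ⟨Or.inr h, ht x h⟩
      refine Finset.card_nbij' (fun s => (s.filter (fun x => g x < M), s.filter (fun x => g x = M)))
        (fun p => p.1 ∪ p.2) ?_ ?_ ?_ ?_
      · intro s hs
        simp only [Finset.coe_filter, Set.mem_ofPred_eq, Finset.mem_filter, Finset.mem_powerset,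
          Finset.subset_iff, Finset.mem_univ, true_and] at hs
        obtain ⟨⟨h1, h2⟩, h3⟩ := hs
        have h4 := (matchesLabels_split hz hf hg hr (M := M)
          (fun x hx => Nat.lt_succ_iff.mp (h1 hx)) (Finset.nonempty_iff_ne_empty.mpr h3)).mp h2
        simp only [Finset.coe_product, Set.mem_prod, Finset.mem_coe, Finset.mem_filter,
          Finset.mem_powerset, Finset.mem_powersetCard, Finset.subset_iff, Finset.mem_univ,
          true_and]
        exact ⟨⟨fun x hx => hx.2, h4.1⟩, fun x hx => hx.2, h4.2⟩
      · rintro ⟨u, t⟩ hp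
        simp only [Finset.coe_product, Set.mem_prod, Finset.mem_coe, Finset.mem_filter,
          Finset.mem_powerset, Finset.mem_powersetCard, Finset.subset_iff, Finset.mem_univ,
          true_and] at hp
        obtain ⟨⟨h1, h2⟩, h3, h4⟩ := hp
        obtain ⟨e1, e2⟩ := hun u t (fun x hx => h1 hx) (fun x hx => h3 hx)
        have htne : t ≠ ∅ := by
          rintro rfl
          have := hz r
          simp at h4
          omega
        have hle : ∀ x ∈ u ∪ t, g x ≤ M := fun x hx => by
          rcases Finset.mem_union.mp hx with h | h
          · exact (h1 h).le
          · exact (h3 h).le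
        have h5 := (matchesLabels_split hz hf hg hr hle
          (by rw [e2]; exact Finset.nonempty_iff_ne_empty.mpr htne)).mpr
          (by rw [e1, e2]; exact ⟨h2, h4⟩)
        simp only [Finset.coe_filter, Set.mem_ofPred_eq, Finset.mem_filter, Finset.mem_powerset,
          Finset.subset_iff, Finset.mem_univ, true_and]
        exact ⟨⟨fun x hx => Nat.lt_succ_iff.mpr (hle x hx), h5⟩, by rw [e2]; exact htne⟩
      · intro s hs
        simp only [Finset.coe_filter, Set.mem_ofPred_eq, Finset.mem_filter, Finset.mem_powerset,
          Finset.subset_iff, Finset.mem_univ, true_and] at hs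
        obtain ⟨⟨h1, h2⟩, h3⟩ := hs
        ext x
        simp only [Finset.mem_union, Finset.mem_filter]
        refine ⟨fun h => h.elim And.left And.left, fun h => ?_⟩
        have := h1 h
        rcases Nat.lt_or_ge (g x) M with h' | h'
        · exact Or.inl ⟨h, h'⟩
        · exact Or.inr ⟨h, by omega⟩
      · rintro ⟨u, t⟩ hp
        simp only [Finset.coe_product, Set.mem_prod, Finset.mem_coe, Finset.mem_filter,
          Finset.mem_powerset, Finset.mem_powersetCard, Finset.subset_iff, Finset.mem_univ,
          true_and] at hp
        obtain ⟨e1, e2⟩ := hun u t (fun x hx => hp.1.1 hx) (fun x hx => hp.2.1 hx)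
        exact Prod.ext e1 e2

end Counting

/-! ### Copies in layered permutations and realization of layer sizes -/

/-- `π` is layered, and its layers are the nonempty level sets of `g`. -/
def LayeredBy {n : ℕ} (π : Equiv.Perm (Fin n)) (g : Fin n → ℕ) : Prop :=
  (∀ x y, g x = g y → x < y → π y < π x) ∧ ∀ x y, g x < g y → π x < π y

theorem LayeredBy.lt_iff {n : ℕ} {π : Equiv.Perm (Fin n)} {g : Fin n → ℕ} (h : LayeredBy π g)
    (hg : Monotone g) {x y : Fin n} (hxy : x < y) : π x < π y ↔ g x ≠ g y := by
  refine ⟨fun h1 h2 => lt_asymm h1 (h.1 x y h2 hxy), fun h1 => ?_⟩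
  exact h.2 x y (lt_of_le_of_ne (hg hxy.le) h1)

theorem rank_orderEmbOfFin {m n : ℕ} (s : Finset (Fin n)) (h : s.card = m) (j : Fin m) :
    rank s (s.orderEmbOfFin h j) = j := by
  have : s.filter (· < s.orderEmbOfFin h j) =
      (Finset.univ.filter (· < j)).map (s.orderEmbOfFin h).toEmbedding := by
    ext y
    simp only [Finset.mem_filter, Finset.mem_map, Finset.mem_univ, true_and]
    constructor
    · rintro ⟨hy, hlt⟩
      have hy' : y ∈ Set.range (s.orderEmbOfFin h) := by
        rw [Finset.range_orderEmbOfFin]; exact hy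
      obtain ⟨i, rfl⟩ := hy'
      exact ⟨i, by simpa using hlt, rfl⟩
    · rintro ⟨i, hi, rfl⟩
      exact ⟨Finset.orderEmbOfFin_mem s h i, by simpa using hi⟩
  rw [rank, this, Finset.card_map, Finset.filter_gt_eq_Iio, Fin.card_Iio]

/-- For two points in increasing order, a layered permutation preserves their order exactly when
their labels differ, so inducing depends on label equality alone. -/
theorem induces_iff {m n : ℕ} {σ : Equiv.Perm (Fin m)} {π : Equiv.Perm (Fin n)} {f : ℕ → ℕ}
    {g : Fin n → ℕ} (hfm : Monotone fun j : Fin m => f j) (hg : Monotone g)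
    (hσ : LayeredBy σ fun j => f j) (hπ : LayeredBy π g) (s : Finset (Fin n)) :
    Induces π s σ ↔ s.card = m ∧ MatchesLabels f g s := by
  have hsurj : ∀ h : s.card = m, ∀ x ∈ s, ∃ j, s.orderEmbOfFin h j = x := fun h x hx => by
    have hx' : x ∈ Set.range (s.orderEmbOfFin h) := by
      rw [Finset.range_orderEmbOfFin]; exact hx
    exact hx'
  constructor
  · rintro ⟨h, hi⟩
    refine ⟨h, fun x hx y hy => ?_⟩
    obtain ⟨i, rfl⟩ := hsurj h x hx
    obtain ⟨j, rfl⟩ := hsurj h y hy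
    rw [rank_orderEmbOfFin, rank_orderEmbOfFin]
    rcases lt_trichotomy i j with hij | rfl | hij
    · have := hi i j
      rw [hσ.lt_iff hfm hij, hπ.lt_iff hg (by simpa using hij)] at this
      exact (not_iff_not.mp this).symm
    · simp
    · have := hi j i
      rw [hσ.lt_iff hfm hij, hπ.lt_iff hg (by simpa using hij)] at this
      rw [eq_comm, eq_comm (a := f i)]
      exact (not_iff_not.mp this).symm
  · rintro ⟨h, hm⟩
    refine ⟨h, ?_⟩
    have key : ∀ i j : Fin m, i < j → (σ i < σ j ↔
        π (s.orderEmbOfFin h i) < π (s.orderEmbOfFin h j)) := fun i j hij => by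
      rw [hσ.lt_iff hfm hij, hπ.lt_iff hg (by simpa using hij)]
      have := hm _ (Finset.orderEmbOfFin_mem s h i) _ (Finset.orderEmbOfFin_mem s h j)
      rw [rank_orderEmbOfFin, rank_orderEmbOfFin] at this
      exact (not_iff_not.mpr this).symm
    intro i j
    rcases lt_trichotomy i j with hij | rfl | hij
    · exact key i j hij
    · simp
    · have h1 := key j i hij
      have h2 : σ i ≠ σ j := fun e => hij.ne' (σ.injective e)
      have h3 : π (s.orderEmbOfFin h i) ≠ π (s.orderEmbOfFin h j) := fun e =>
        hij.ne' ((s.orderEmbOfFin h).injective (π.injective e))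
      rw [← not_iff_not, not_lt, not_lt, h2.symm.le_iff_lt, h3.symm.le_iff_lt]
      exact h1

theorem card_induces {m n : ℕ} {σ : Equiv.Perm (Fin m)} {π : Equiv.Perm (Fin n)} {f z : ℕ → ℕ}
    {g : Fin n → ℕ} {k M : ℕ} (hz : ∀ r, 1 ≤ z r)
    (hf : ∀ r < k, ∀ j, f j = r ↔
      ∑ i ∈ Finset.range r, z i ≤ j ∧ j < ∑ i ∈ Finset.range (r + 1), z i)
    (hm : ∑ i ∈ Finset.range k, z i = m)
    (hfm : Monotone fun j : Fin m => f j) (hg : Monotone g) (hgM : ∀ x, g x < M)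
    (hσ : LayeredBy σ fun j => f j) (hπ : LayeredBy π g) :
    ((Finset.powersetCard m (Finset.univ : Finset (Fin n))).filter
      (fun s => Induces π s σ)).card = prefixCount z (labelSizes g M) k := by
  classical
  rw [← card_matchesLabels hz hf hg M k le_rfl]
  congr 1
  ext s
  simp only [Finset.mem_filter, Finset.mem_powersetCard_univ, Finset.mem_powerset,
    induces_iff hfm hg hσ hπ, hm, hgM, Finset.filter_true, Finset.subset_univ, true_and]
  tauto

theorem exists_layeredBy {n : ℕ} (g : Fin n → ℕ) :
    ∃ π : Equiv.Perm (Fin n), LayeredBy π g := by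
  -- Values are assigned by increasing label and, within a label, by decreasing position; the
  -- inverse of the sorting permutation sends a point to its place in this order.
  let key : Fin n → ℕ ×ₗ (Fin n)ᵒᵈ := fun x => toLex (g x, OrderDual.toDual x)
  have hinj : Function.Injective key := fun x y h => by
    have := congrArg (fun p => (ofLex p).2) h
    simpa [key] using this
  have hlt : ∀ x y, key x < key y → (Tuple.sort key).symm x < (Tuple.sort key).symm y := by
    intro x y h
    by_contra hle
    have := Tuple.monotone_sort key (not_lt.mp hle)
    simp only [Function.comp_apply, Equiv.apply_symm_apply] at this
    exact absurd h (not_lt.mpr this)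
  refine ⟨(Tuple.sort key).symm, fun x y h hxy => hlt _ _ ?_, fun x y h => hlt _ _ ?_⟩
  · rw [Prod.Lex.toLex_lt_toLex]
    exact Or.inr ⟨h.symm, by simpa using hxy⟩
  · rw [Prod.Lex.toLex_lt_toLex]
    exact Or.inl h

theorem exists_labelSizes_eq (xs : List ℕ) : ∃ g : Fin xs.sum → ℕ, Monotone g ∧
    (∀ x, g x < xs.length) ∧ labelSizes g xs.length = xs := by
  induction xs with
  | nil => exact ⟨fun _ => 0, monotone_const, fun x => x.elim0, rfl⟩
  | cons a xs ih =>
    obtain ⟨g, hg, hlt, hsz⟩ := ih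
    rw [List.sum_cons, Nat.add_comm]
    refine ⟨Fin.addCases g fun _ => xs.length, ?_, ?_, ?_⟩
    · intro x y hxy
      induction x using Fin.addCases with
      | left x =>
        induction y using Fin.addCases with
        | left y => simpa using hg (show x ≤ y from hxy)
        | right y => simpa using (hlt x).le
      | right x =>
        induction y using Fin.addCases with
        | left y =>
          exfalso
          rw [Fin.le_def] at hxy
          simp at hxy
          omega
        | right y => simp
    · intro x
      induction x using Fin.addCases with
      | left x => simpa using (hlt x).trans (Nat.lt_succ_self _)
      | right x => simp
    · have h1 : ∀ M ≤ xs.length,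
          labelSizes (Fin.addCases g fun _ : Fin a => xs.length) M = labelSizes g M := by
        intro M hM
        induction M with
        | zero => rfl
        | succ M ih =>
          rw [labelSizes, labelSizes, ih (by omega)]
          congr 1
          rw [Finset.card_filter, Finset.card_filter, Fin.sum_univ_add]
          simp
          omega
      rw [List.length_cons, labelSizes, h1 _ le_rfl, hsz]
      congr 1
      rw [Finset.card_filter, Fin.sum_univ_add]
      simp [(hlt _).ne]

theorem labelSizes_index {n : ℕ} (d : Composition n) :
    labelSizes (fun x => (d.index x : ℕ)) d.length = d.blocks.reverse := by
  have h : ∀ M ≤ d.length, labelSizes (fun x => (d.index x : ℕ)) M =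
      (d.blocks.take M).reverse := by
    intro M hM
    induction M with
    | zero => rfl
    | succ M ih =>
      rw [labelSizes, ih (by omega), List.take_succ_eq_append_getElem hM,
        List.reverse_append, List.reverse_singleton, List.singleton_append]
      congr 1
      have : Finset.univ.filter (fun x => (d.index x : ℕ) = M) =
          Finset.univ.map (d.embedding ⟨M, hM⟩).toEmbedding := by
        ext x
        simp only [Finset.mem_filter, Finset.mem_univ, true_and, Finset.mem_map]
        have := d.mem_range_embedding_iff' (j := x) (i := ⟨M, hM⟩)
        rw [Fin.ext_iff, eq_comm] at this
        rw [← this]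
        rfl
      rw [this, Finset.card_map, Finset.card_fin]
      rfl
  rw [h _ le_rfl, Composition.length, List.take_length]

end LayeredPerm

/-! ### Translation from compositions to size sequences -/

theorem mainTheorem4 (m : ℕ) (σ : Equiv.Perm (Fin m)) (c : Composition m)
    (hσ : LayeredPerm.HasLayers σ c) (hk : 2 ≤ c.length)
    (hlast : c.blocksFun ⟨c.length - 1, by omega⟩ = c.blocksFun ⟨0, by omega⟩)
    (hfirst : 2 ≤ c.blocksFun ⟨0, by omega⟩)
    (hcons : ∀ (i : ℕ) (hi : i + 1 < c.length),
      c.blocksFun ⟨i, by omega⟩ = c.blocksFun ⟨0, by omega⟩ ∨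
        c.blocksFun ⟨i + 1, hi⟩ = c.blocksFun ⟨0, by omega⟩) :
    ∃ K : ℕ, ∀ (n : ℕ) (π : Equiv.Perm (Fin n)) (d : Composition n),
      LayeredPerm.HasLayers π d → LayeredPerm.IsOptimal σ π → d.length ≤ K := by
  have hidx : ∀ {n : ℕ} (d : Composition n), Monotone fun x => (d.index x : ℕ) := by
    intro n d x y hxy
    by_contra hlt
    have h1 := d.sizeUpTo_index_le x
    have h2 := d.lt_sizeUpTo_index_succ y
    have h3 := d.monotone_sizeUpTo (show (d.index y : ℕ).succ ≤ d.index x from not_le.mp hlt)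
    exact absurd hxy (not_le.mpr (Fin.lt_def.mpr (h2.trans_le (h3.trans h1))))
  -- The default 1 makes every `z r` positive, also beyond the pattern.
  let z : ℕ → ℕ := fun r => if h : r < c.length then c.blocksFun ⟨r, h⟩ else 1
  have hzr : ∀ r (h : r < c.length), z r = c.blocksFun ⟨r, h⟩ := fun r h => dif_pos h
  have hz : ∀ r, 1 ≤ z r := fun r => by
    by_cases h : r < c.length
    · rw [hzr r h]; exact c.one_le_blocksFun _
    · rw [show z r = 1 from dif_neg h]
  have hS : ∀ r ≤ c.length, ∑ i ∈ Finset.range r, z i = c.sizeUpTo r := by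
    intro r hr
    induction r with
    | zero => simp
    | succ r ih =>
      rw [Finset.sum_range_succ, ih (by omega), hzr r hr, c.sizeUpTo_succ hr]
      rfl
  have hm : ∑ i ∈ Finset.range c.length, z i = m := by rw [hS _ le_rfl, c.sizeUpTo_length]
  -- The default `c.length` keeps indices outside the pattern from receiving the label of a layer.
  let f : ℕ → ℕ := fun j => if h : j < m then c.index ⟨j, h⟩ else c.length
  have hfj : ∀ j : Fin m, f j = c.index j := fun j => dif_pos j.2
  have hf : ∀ r < c.length, ∀ j, f j = r ↔
      ∑ i ∈ Finset.range r, z i ≤ j ∧ j < ∑ i ∈ Finset.range (r + 1), z i := by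
    intro r hr j
    rw [hS _ hr.le, hS (r + 1) hr]
    by_cases hj : j < m
    · have h1 := c.mem_range_embedding_iff' (j := ⟨j, hj⟩) (i := ⟨r, hr⟩)
      rw [c.mem_range_embedding_iff, Fin.ext_iff, eq_comm] at h1
      rw [hfj ⟨j, hj⟩]
      exact h1.symm
    · have h1 : f j = c.length := dif_neg hj
      have h2 := c.sizeUpTo_le (r + 1)
      omega
  have hfun : (fun j : Fin m => f j) = fun j => (c.index j : ℕ) := funext hfj
  have hfm : Monotone fun j : Fin m => f j := hfun ▸ hidx c
  have hσ' : LayeredPerm.LayeredBy σ fun j => f j := by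
    rw [hfun]
    exact ⟨fun x y h => hσ.1 x y (Fin.ext h), fun x y h => hσ.2 x y h⟩
  obtain ⟨K, hK⟩ := LayeredPerm.exists_length_le (z := z) (k := c.length) hz hfirst (by omega)
    (hzr 0 (by omega)) ((hzr _ (by omega)).trans hlast) fun i hi => by
      rw [hzr i (by omega), hzr (i + 1) hi]; exact hcons i hi
  refine ⟨K, fun n π d hπ hopt => ?_⟩
  have hsum : d.blocks.reverse.sum = n := by rw [List.sum_reverse, d.blocks_sum]
  have hπ' : LayeredPerm.LayeredBy π fun x => (d.index x : ℕ) :=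
    ⟨fun x y h => hπ.1 x y (Fin.ext h), fun x y h => hπ.2 x y h⟩
  have hcount := LayeredPerm.card_induces hz hf hm hfm (hidx d) (fun x => (d.index x).2) hσ' hπ'
  rw [LayeredPerm.labelSizes_index] at hcount
  have hmain := hK d.blocks.reverse (fun x hx => d.one_le_blocks (List.mem_reverse.mp hx))
    (by rw [hm, hsum]; exact hopt.1) fun ys hys => by
      rw [hsum] at hys
      subst hys
      -- Sizes in `ys` may be zero; labels with empty level sets take care of these.
      obtain ⟨g, hg, hlt, hsz⟩ := LayeredPerm.exists_labelSizes_eq ys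
      obtain ⟨τ, hτ⟩ := LayeredPerm.exists_layeredBy g
      have hcτ := LayeredPerm.card_induces hz hf hm hfm hg hlt hσ' hτ
      rw [hsz] at hcτ
      rw [← hcτ, ← hcount]
      have h1 := hopt.2 τ
      unfold LayeredPerm.density at h1
      have hpos : (0 : ℚ) < (Finset.powersetCard m (Finset.univ : Finset (Fin ys.sum))).card := by
        rw [Finset.card_powersetCard, Finset.card_fin]
        exact_mod_cast Nat.choose_pos hopt.1
      rw [div_le_div_iff_of_pos_right hpos] at h1
      exact_mod_cast h1
  rwa [List.length_reverse] at hmain
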